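/- Let $(\Omega,\mathcal F,\mathbb P)$ be a probability space, $\mathcal G\subseteq\mathcal F$ a sub-$\sigma$-algebra, and $p,q\in[1,\infty]$ with $\frac1p+\frac1q=1$. Let $L^p(\mathcal F)$ carry the norm topology if $p<\infty$ and the weak$^*$ topology $\sigma(L^\infty(\mathcal F),L^1(\mathcal F))$ if $p=\infty$; let $L^p(\mathcal G)$ be the subspace of $\mathcal G$-measurable elements of $L^p(\mathcal F)$, and $L^q_+(\mathcal G)$ the set of almost surely nonnegative elements of $L^q(\mathcal G)$. All (in)equalities between random variables are meant $\mathbb P$-almost surely. Suppose that $\mathcal G$ is non-trivial, i.e. there is $A_0\in\mathcal G$ with $0<\mathbb P(A_0)<1$. Let $\rho:L^p(\mathcal F)\to L^p(\mathcal G)$ be a conditional risk measure, i.e. - $\rho(X)\ge\rho(Y)$ for all $X,Y\in L^p(\mathcal F)$ with $X\le Y$, and - $\rho(\lambda X+(1-\lambda)Y)\le\max\{\rho(X),\rho(Y)\}$ for all $X,Y\in L^p(\mathcal F)$, $\lambda\in[0,1]$. Assume moreover that - $\rho$ is local: $\rho(X\mathbf 1_A)\mathbf 1_A=\rho(X)\mathbf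 1_A$ for all $X\in L^p(\mathcal F)$ and $A\in\mathcal G$; - $\rho$ is $\star$-lower semicontinuous: for every $Z^*\in L^q_+(\mathcal G)$ the function $X\mapsto\mathbb E[\rho(X)Z^*]$ is lower semicontinuous on $L^p(\mathcal F)$; - for every $A\in\mathcal G$ with $\mathbb P(A)>0$, the function $X\mapsto\mathbb E[\rho(X)\mathbf 1_A]$ is non-constant on $L^p(\mathcal F)$. Then $\rho$ is convex, i.e. $\rho(\lambda X+(1-\lambda)Y)\le\lambda\rho(X)+(1-\lambda)\rho(Y)$ for all $X,Y\in L^p(\mathcal F)$ and $\lambda\in[0,1]$, if and only if $\rho$ is naturally quasiconvex, i.e. for all $X,Y\in L^p(\mathcal F)$ and $\lambda\in[0,1]$ there exists $\mu\in[0,1]$ such that $\rho(\lambda X+(1-\lambda)Y)\le\mu\rho(X)+(1-\mu)\rho(Y)$. -/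

import Mathlib

open MeasureTheory
open scoped ENNReal

noncomputable section

namespace CondRisk

/-- The topology used on `L^p(F)`: the norm topology for `p < ∞`, and the weak-star topology
`σ(L^∞(F), L^1(F))` for `p = ∞`, i.e. the coarsest topology for which `X ↦ E[X Z]` is continuous
for every `Z ∈ L^1(F)`. -/
@[reducible] def lpTopology {Ω : Type*} {mF : MeasurableSpace Ω} (P : Measure Ω) (p : ℝ≥0∞) [Fact (1 ≤ p)] :
    TopologicalSpace (Lp ℝ p P) :=
  open Classical in
  if p = ∞ then
    ⨅ Z : Lp ℝ 1 P, TopologicalSpace.induced (fun X : Lp ℝ p P => ∫ ω, X ω * Z ω ∂P)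
      (inferInstance : TopologicalSpace ℝ)
  else (inferInstance : TopologicalSpace (Lp ℝ p P))

/-- The random variable `X 1_A`, as an element of `L^p(F)`. -/
def restrictTo {Ω : Type*} {mF : MeasurableSpace Ω} {P : Measure Ω} {p : ℝ≥0∞}
    (A : Set Ω) (hA : MeasurableSet A) (X : Lp ℝ p P) : Lp ℝ p P :=
  ((Lp.memLp X).indicator hA).toLp (A.indicator X)

section Properties

/- In what follows `L^p(G)` is `lpMeas ℝ ℝ mG p P`: the subspace of all elements of `L^p(F)` which
are (almost surely equal to) a `mG`-measurable function. The order on `Lp ℝ p P` is the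
almost sure one and `⊔` is the almost sure pointwise maximum. -/

variable {Ω : Type*} {mG mF : MeasurableSpace Ω} {P : Measure Ω} {p : ℝ≥0∞}

/-- Conditional risk measures: monotone (decreasing) and quasiconvex maps `L^p(F) → L^p(G)`. -/
structure IsConditionalRiskMeasure (ρ : Lp ℝ p P → lpMeas ℝ ℝ mG p P) : Prop where
  monotone : ∀ X Y : Lp ℝ p P, X ≤ Y → (ρ Y : Lp ℝ p P) ≤ (ρ X : Lp ℝ p P)
  quasiconvex : ∀ X Y : Lp ℝ p P, ∀ t ∈ Set.Icc (0 : ℝ) 1,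
    (ρ (t • X + (1 - t) • Y) : Lp ℝ p P) ≤ (ρ X : Lp ℝ p P) ⊔ (ρ Y : Lp ℝ p P)

/-- Locality: `ρ(X 1_A) 1_A = ρ(X) 1_A` for all `X ∈ L^p(F)` and `A ∈ G`. -/
def IsLocal (hG : mG ≤ mF) (ρ : Lp ℝ p P → lpMeas ℝ ℝ mG p P) : Prop :=
  ∀ (X : Lp ℝ p P) (A : Set Ω) (hA : MeasurableSet[mG] A),
    restrictTo A (hG A hA) (ρ (restrictTo A (hG A hA) X) : Lp ℝ p P) =
      restrictTo A (hG A hA) (ρ X : Lp ℝ p P)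

/-- Convexity, with respect to the almost sure order. -/
def IsConvex (ρ : Lp ℝ p P → lpMeas ℝ ℝ mG p P) : Prop :=
  ∀ X Y : Lp ℝ p P, ∀ t ∈ Set.Icc (0 : ℝ) 1,
    (ρ (t • X + (1 - t) • Y) : Lp ℝ p P) ≤
      t • (ρ X : Lp ℝ p P) + (1 - t) • (ρ Y : Lp ℝ p P)

/-- Natural quasiconvexity; the number `s` may depend on `X`, `Y` and `t`. -/
def IsNaturallyQuasiconvex (ρ : Lp ℝ p P → lpMeas ℝ ℝ mG p P) : Prop :=
  ∀ X Y : Lp ℝ p P, ∀ t ∈ Set.Icc (0 : ℝ) 1, ∃ s ∈ Set.Icc (0 : ℝ) 1,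
    (ρ (t • X + (1 - t) • Y) : Lp ℝ p P) ≤
      s • (ρ X : Lp ℝ p P) + (1 - s) • (ρ Y : Lp ℝ p P)

/-- `⋆`-lower semicontinuity: for every `Z ∈ L^q_+(G)`, where `q` is the conjugate exponent of
`p`, the function `X ↦ E[ρ(X) Z]` is lower semicontinuous on `L^p(F)`. -/
def IsStarLSC [Fact (1 ≤ p)] (q : ℝ≥0∞) [ENNReal.HolderConjugate p q]
    (ρ : Lp ℝ p P → lpMeas ℝ ℝ mG p P) : Prop :=
  ∀ Z : lpMeas ℝ ℝ mG q P, 0 ≤ (Z : Lp ℝ q P) →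
    @LowerSemicontinuous (Lp ℝ p P) ℝ (lpTopology P p) _
      (fun X : Lp ℝ p P => ∫ ω, (ρ X : Lp ℝ p P) ω * (Z : Lp ℝ q P) ω ∂P)

/-- For every `A ∈ G` with `P(A) > 0`, the function `X ↦ E[ρ(X) 1_A]` is not constant. -/
def IsNowhereConstant (ρ : Lp ℝ p P → lpMeas ℝ ℝ mG p P) : Prop :=
  ∀ A : Set Ω, MeasurableSet[mG] A → 0 < P A →
    ∃ X Y : Lp ℝ p P, ∫ ω in A, (ρ X : Lp ℝ p P) ω ∂P ≠ ∫ ω in A, (ρ Y : Lp ℝ p P) ω ∂P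

end Properties

end CondRisk

end

/-! Convexity gives natural quasiconvexity with μ = λ. Conversely, by locality arguments can be
glued along A ∈ G, so a single weight serves both f = E[ρ 1_A] and g = E[ρ 1_Aᶜ]
(`IsNaturallyQuasiconvex.jointly`). If f broke midpoint convexity, the forced weight would exceed
1/2 by a fixed amount, and g would obey a uniformly strengthened midpoint inequality on every pair;
`exists_midpoint_rise_gt` excludes this for nonconstant g. So f is convex whenever P(A) < 1, and
cutting along A₀ reaches every A ∈ G. -/

/-! ### Real-valued quasiconvex functions with a common weight -/

theorem exists_midpoint_rise_gt {ψ : ℝ → ℝ}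
    (hq : ∀ a b, ψ ((a + b) / 2) ≤ max (ψ a) (ψ b)) (h : ψ (-1) < ψ 0) {ε : ℝ} (hε : 0 < ε) :
    ∃ a b, ψ a < ψ b ∧ ψ a + (1 / 2 - ε) * (ψ b - ψ a) < ψ ((a + b) / 2) := by
  by_contra! H
  -- Under `H`, the right half of a rising interval carries at least the fraction 1/2 + ε of its
  -- rise.
  have hd : ∀ n : ℕ, (1 / 2 + ε) ^ n * (ψ 0 - ψ (-1)) ≤ ψ 0 - ψ (-(1 / 2) ^ n) := by
    intro n
    induction n with
    | zero => simp
    | succ n ih =>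
      have hpos : 0 < (1 / 2 + ε) ^ n * (ψ 0 - ψ (-1)) := by
        have := sub_pos.2 h
        positivity
      have h1 := H (-(1 / 2) ^ n) 0 (by linarith)
      rw [show (-(1 / 2) ^ n + 0) / 2 = -(1 / 2 : ℝ) ^ (n + 1) by ring] at h1
      have h2 := mul_le_mul_of_nonneg_left ih (by positivity : (0 : ℝ) ≤ 1 / 2 + ε)
      calc _ = (1 / 2 + ε) * ((1 / 2 + ε) ^ n * (ψ 0 - ψ (-1))) := by ring
        _ ≤ _ := h2
        _ ≤ _ := by linarith
  -- Increments on the grid of mesh 2⁻ⁿ never decrease to the right: after a rise, `hq` forbids a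
  -- fall and `H` makes the next increment at least as large.
  have hstep : ∀ n k : ℕ, ψ 0 - ψ (-(1 / 2) ^ n) ≤
      ψ (k * (1 / 2) ^ n) - ψ ((k - 1) * (1 / 2) ^ n) := by
    intro n k
    have hpos : 0 < ψ 0 - ψ (-(1 / 2) ^ n) := by
      have := sub_pos.2 h
      exact lt_of_lt_of_le (by positivity) (hd n)
    induction k with
    | zero => simp
    | succ k ih =>
      have hm : ((k - 1) * (1 / 2) ^ n + (k + 1) * (1 / 2) ^ n) / 2 = (k : ℝ) * (1 / 2) ^ n := by
        ring
      have h1 := hq ((k - 1) * (1 / 2) ^ n) ((k + 1) * (1 / 2) ^ n)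
      have h2 := H ((k - 1) * (1 / 2) ^ n) ((k + 1) * (1 / 2) ^ n)
      rw [hm] at h1 h2
      have h3 : ψ (k * (1 / 2) ^ n) ≤ ψ ((k + 1) * (1 / 2) ^ n) := by
        rcases le_max_iff.1 h1 with h1 | h1 <;> linarith
      have h4 := h2 (by linarith)
      push_cast
      rw [add_sub_cancel_right]
      nlinarith
  have hsum : ∀ n k : ℕ, k * (ψ 0 - ψ (-(1 / 2) ^ n)) ≤ ψ (k * (1 / 2) ^ n) - ψ 0 := by
    intro n k
    induction k with
    | zero => simp
    | succ k ih =>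
      have := hstep n (k + 1)
      push_cast at this ⊢
      rw [add_sub_cancel_right] at this
      linarith
  -- The 2ⁿ increments from 0 to 1 force a rise growing geometrically in n, which is absurd.
  have hbound : ∀ n : ℕ, (1 + 2 * ε) ^ n * (ψ 0 - ψ (-1)) ≤ ψ 1 - ψ 0 := by
    intro n
    have h1 := hsum n (2 ^ n)
    have h2 : ((2 ^ n : ℕ) : ℝ) * (1 / 2) ^ n = 1 := by
      push_cast
      rw [← mul_pow]
      norm_num
    rw [h2] at h1
    calc (1 + 2 * ε) ^ n * (ψ 0 - ψ (-1))
        = ((2 ^ n : ℕ) : ℝ) * ((1 / 2 + ε) ^ n * (ψ 0 - ψ (-1))) := by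
          push_cast
          rw [← mul_assoc, ← mul_pow]
          ring
      _ ≤ ((2 ^ n : ℕ) : ℝ) * (ψ 0 - ψ (-(1 / 2) ^ n)) :=
          mul_le_mul_of_nonneg_left (hd n) (by positivity)
      _ ≤ _ := h1
  obtain ⟨n, hn⟩ := pow_unbounded_of_one_lt ((ψ 1 - ψ 0) / (ψ 0 - ψ (-1)))
    (by linarith : 1 < 1 + 2 * ε)
  rw [div_lt_iff₀ (sub_pos.2 h)] at hn
  exact absurd (hbound n) (not_le.2 hn)

/-- Each t is the midpoint of an endpoint and 2t or 2t - 1, so every doubling halves the upper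
bound. -/
theorem nonpos_of_midpoint_convex_of_bddAbove {h : ℝ → ℝ} {C : ℝ}
    (hmid : ∀ a ∈ Set.Icc (0 : ℝ) 1, ∀ b ∈ Set.Icc (0 : ℝ) 1, h ((a + b) / 2) ≤ (h a + h b) / 2)
    (h0 : h 0 ≤ 0) (h1 : h 1 ≤ 0) (hC : ∀ t ∈ Set.Icc (0 : ℝ) 1, h t ≤ C)
    {t : ℝ} (ht : t ∈ Set.Icc (0 : ℝ) 1) : h t ≤ 0 := by
  have key : ∀ n : ℕ, ∀ t ∈ Set.Icc (0 : ℝ) 1, h t ≤ C * (1 / 2) ^ n := by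
    intro n
    induction n with
    | zero => simpa using hC
    | succ n ih =>
      rintro t ⟨ht0, ht1⟩
      rw [pow_succ]
      rcases le_total t (1 / 2) with h2 | h2
      · have h3 : 2 * t ∈ Set.Icc (0 : ℝ) 1 := ⟨by linarith, by linarith⟩
        have h4 := hmid 0 (by simp) (2 * t) h3
        rw [show (0 + 2 * t) / 2 = t by ring] at h4
        linarith [ih _ h3]
      · have h3 : 2 * t - 1 ∈ Set.Icc (0 : ℝ) 1 := ⟨by linarith, by linarith⟩
        have h4 := hmid 1 (by simp) (2 * t - 1) h3
        rw [show (1 + (2 * t - 1)) / 2 = t by ring] at h4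
        linarith [ih _ h3]
  have hlim : Filter.Tendsto (fun n : ℕ => C * (1 / 2 : ℝ) ^ n) Filter.atTop (nhds (C * 0)) :=
    (tendsto_pow_atTop_nhds_zero_of_lt_one (by norm_num) (by norm_num)).const_mul C
  rw [mul_zero] at hlim
  exact ge_of_tendsto' hlim fun n => key n t ht

/-- If `f` and `g` are quasiconvex with a common weight and `g` is not constant,
then `f` is convex. -/
theorem convexOn_of_jointly_naturally_quasiconvex {E : Type*} [AddCommGroup E] [Module ℝ E]
    {f g : E → ℝ}
    (hN : ∀ x y u v : E, ∀ t ∈ Set.Icc (0 : ℝ) 1, ∃ s ∈ Set.Icc (0 : ℝ) 1,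
      f (t • x + (1 - t) • y) ≤ s * f x + (1 - s) * f y ∧
      g (t • u + (1 - t) • v) ≤ s * g u + (1 - s) * g v)
    (hg : ∃ u v, g u ≠ g v) : ConvexOn ℝ Set.univ f := by
  have hle : ∀ {s a b : ℝ}, s ∈ Set.Icc (0 : ℝ) 1 → s * a + (1 - s) * b ≤ max a b := by
    rintro s a b ⟨h0, h1⟩
    nlinarith [mul_le_mul_of_nonneg_left (le_max_left a b) h0,
      mul_le_mul_of_nonneg_left (le_max_right a b) (sub_nonneg.2 h1)]
  have hfq : ∀ x y : E, ∀ t ∈ Set.Icc (0 : ℝ) 1, f (t • x + (1 - t) • y) ≤ max (f x) (f y) := by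
    intro x y t ht
    obtain ⟨s, hs, h1, -⟩ := hN x y x y t ht
    exact h1.trans (hle hs)
  have hhalf : (1 / 2 : ℝ) ∈ Set.Icc (0 : ℝ) 1 := ⟨by norm_num, by norm_num⟩
  obtain ⟨u, v, huv⟩ : ∃ u v, g u < g v := by
    obtain ⟨u, v, h⟩ := hg
    rcases lt_or_gt_of_ne h with h | h
    exacts [⟨u, v, h⟩, ⟨v, u, h⟩]
  have hline : ∀ a b : ℝ, (1 / 2 : ℝ) • (v + a • (v - u)) + (1 - 1 / 2 : ℝ) • (v + b • (v - u)) =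
      v + ((a + b) / 2) • (v - u) := by
    intro a b
    module
  have hmid_lt : ∀ x y : E, f y < f x →
      f ((1 / 2 : ℝ) • x + (1 - 1 / 2 : ℝ) • y) ≤ (f x + f y) / 2 := by
    intro x y hxy
    by_contra! hlt
    set m := f ((1 / 2 : ℝ) • x + (1 - 1 / 2 : ℝ) • y)
    have hpos := sub_pos.2 hxy
    -- Here 1/2 + ε is the least weight on `x` compatible with the value `m`; the same weight falls
    -- on the lower value of g and contradicts `hrise`.
    obtain ⟨a, b, hab, hrise⟩ := exists_midpoint_rise_gt (ψ := fun r => g (v + r • (v - u)))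
      (ε := (m - f y) / (f x - f y) - 1 / 2)
      (fun a b => by
        obtain ⟨s, hs, -, h1⟩ := hN x x (v + a • (v - u)) (v + b • (v - u)) _ hhalf
        rw [hline] at h1
        exact h1.trans (hle hs))
      (by simpa using huv)
      (by rw [sub_pos, lt_div_iff₀ hpos]; linarith)
    obtain ⟨s, hs, h1, h2⟩ := hN x y (v + a • (v - u)) (v + b • (v - u)) _ hhalf
    rw [hline] at h2
    change m ≤ _ at h1
    have h3 : (m - f y) / (f x - f y) ≤ s := by
      rw [div_le_iff₀ hpos]
      linarith
    have h4 := mul_le_mul_of_nonneg_right h3 (sub_pos.2 hab).le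
    linarith
  have hmid : ∀ x y : E, f ((1 / 2 : ℝ) • x + (1 - 1 / 2 : ℝ) • y) ≤ (f x + f y) / 2 := by
    intro x y
    rcases lt_trichotomy (f x) (f y) with h | h | h
    · have := hmid_lt y x h
      rw [show (1 / 2 : ℝ) • x + (1 - 1 / 2 : ℝ) • y = (1 / 2 : ℝ) • y + (1 - 1 / 2 : ℝ) • x by
        module]
      linarith
    · have := hfq x y _ hhalf
      rw [h, max_self] at this
      linarith
    · exact hmid_lt x y h
  refine ⟨convex_univ, fun x _ y _ a b ha hb hab => ?_⟩
  obtain rfl : b = 1 - a := by linarith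
  have := nonpos_of_midpoint_convex_of_bddAbove
    (h := fun t => f (t • x + (1 - t) • y) - (t * f x + (1 - t) * f y))
    -- Quasiconvexity bounds f on the segment, which upgrades midpoint convexity to convexity.
    (C := max (f x) (f y) + |f x| + |f y|)
    (fun s _ t _ => by
      have := hmid (s • x + (1 - s) • y) (t • x + (1 - t) • y)
      rw [show (1 / 2 : ℝ) • (s • x + (1 - s) • y) + (1 - 1 / 2 : ℝ) • (t • x + (1 - t) • y) =
        ((s + t) / 2) • x + (1 - (s + t) / 2) • y by module] at this
      linarith)
    (by simp) (by simp)
    (fun t ht => by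
      have h1 := hfq x y t ht
      have h2 : -|f x| ≤ t * f x := by
        nlinarith [neg_abs_le (f x), abs_nonneg (f x), ht.1, ht.2]
      have h3 : -|f y| ≤ (1 - t) * f y := by
        nlinarith [neg_abs_le (f y), abs_nonneg (f y), ht.1, ht.2]
      linarith)
    (t := a) ⟨ha, by linarith⟩
  simp only [smul_eq_mul]
  linarith

/-! ### Transfer to conditional risk measures -/

namespace CondRisk

variable {Ω : Type*} {mG mF : MeasurableSpace Ω} {P : Measure Ω} {p : ℝ≥0∞}

theorem coeFn_restrictTo {A : Set Ω} (hA : MeasurableSet A) (X : Lp ℝ p P) :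
    restrictTo A hA X =ᵐ[P] A.indicator X :=
  MemLp.coeFn_toLp _

theorem restrictTo_congr {A : Set Ω} (hA : MeasurableSet A) {X Y : Lp ℝ p P}
    (h : ∀ᵐ ω ∂P, ω ∈ A → X ω = Y ω) : restrictTo A hA X = restrictTo A hA Y := by
  refine Lp.ext ?_
  filter_upwards [coeFn_restrictTo hA X, coeFn_restrictTo hA Y, h] with ω h1 h2 h3
  rw [h1, h2]
  by_cases hω : ω ∈ A <;> simp [hω, h3]

theorem IsLocal.ae_eq_of_ae_eq {hG : mG ≤ mF} {ρ : Lp ℝ p P → lpMeas ℝ ℝ mG p P}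
    (hρ : IsLocal hG ρ) {A : Set Ω} (hA : MeasurableSet[mG] A) {X Y : Lp ℝ p P}
    (h : ∀ᵐ ω ∂P, ω ∈ A → X ω = Y ω) :
    ∀ᵐ ω ∂P, ω ∈ A → (ρ X : Lp ℝ p P) ω = (ρ Y : Lp ℝ p P) ω := by
  have h1 : restrictTo A (hG A hA) (ρ X : Lp ℝ p P) = restrictTo A (hG A hA) (ρ Y : Lp ℝ p P) := by
    rw [← hρ X A hA, ← hρ Y A hA, restrictTo_congr (hG A hA) h]
  filter_upwards [coeFn_restrictTo (hG A hA) (ρ X : Lp ℝ p P),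
    coeFn_restrictTo (hG A hA) (ρ Y : Lp ℝ p P)] with ω h2 h3 hω
  rw [h1, h3] at h2
  simpa [hω] using h2.symm

theorem integrable_coeFn [IsFiniteMeasure P] (hp : 1 ≤ p) (X : Lp ℝ p P) : Integrable X P :=
  (Lp.memLp X).integrable hp

theorem coeFn_combination (a b : ℝ) (X Y : Lp ℝ p P) :
    ⇑(a • X + b • Y) =ᵐ[P] fun ω => a * X ω + b * Y ω := by
  filter_upwards [Lp.coeFn_add (a • X) (b • Y), Lp.coeFn_smul a X, Lp.coeFn_smul b Y]
    with ω h1 h2 h3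
  rw [h1, Pi.add_apply, h2, h3, Pi.smul_apply, Pi.smul_apply, smul_eq_mul, smul_eq_mul]

theorem setIntegral_le_of_le_combination [IsFiniteMeasure P] (hp : 1 ≤ p) {A : Set Ω}
    {X Y W : Lp ℝ p P} {s : ℝ} (h : W ≤ s • X + (1 - s) • Y) :
    ∫ ω in A, W ω ∂P ≤ s * (∫ ω in A, X ω ∂P) + (1 - s) * ∫ ω in A, Y ω ∂P := by
  rw [← integral_const_mul, ← integral_const_mul, ← integral_add
    ((integrable_coeFn hp X).integrableOn.const_mul s)
    ((integrable_coeFn hp Y).integrableOn.const_mul (1 - s))]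
  refine setIntegral_mono_ae (integrable_coeFn hp W).integrableOn
    (((integrable_coeFn hp X).const_mul s).add
      ((integrable_coeFn hp Y).const_mul (1 - s))).integrableOn ?_
  filter_upwards [(Lp.coeFn_le _ _).2 h, coeFn_combination s (1 - s) X Y] with ω h1 h2
  rwa [h2] at h1

/-- `G`-measurable elements of `L^p` can be compared through their integrals over sets of `G`. -/
theorem le_of_forall_setIntegral_le [IsFiniteMeasure P] (hG : mG ≤ mF) (hp : 1 ≤ p)
    (X Y : lpMeas ℝ ℝ mG p P)
    (h : ∀ A, MeasurableSet[mG] A →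
      ∫ ω in A, (X : Lp ℝ p P) ω ∂P ≤ ∫ ω in A, (Y : Lp ℝ p P) ω ∂P) :
    (X : Lp ℝ p P) ≤ (Y : Lp ℝ p P) := by
  obtain ⟨X', hX', hXX'⟩ := mem_lpMeas_iff_aestronglyMeasurable.1 X.2
  obtain ⟨Y', hY', hYY'⟩ := mem_lpMeas_iff_aestronglyMeasurable.1 Y.2
  have hXi : Integrable X' P := (integrable_coeFn hp (X : Lp ℝ p P)).congr hXX'
  have hYi : Integrable Y' P := (integrable_coeFn hp (Y : Lp ℝ p P)).congr hYY'
  have hle : X' ≤ᵐ[P.trim hG] Y' := by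
    refine ae_le_of_forall_setIntegral_le (hXi.trim hG hX') (hYi.trim hG hY') fun A hA _ => ?_
    rw [← setIntegral_trim hG hX' hA, ← setIntegral_trim hG hY' hA]
    have := h A hA
    rwa [integral_congr_ae (ae_restrict_of_ae hXX'), integral_congr_ae (ae_restrict_of_ae hYY')]
      at this
  rw [← Lp.coeFn_le]
  filter_upwards [ae_le_of_ae_le_trim hle, hXX', hYY'] with ω h1 h2 h3
  rwa [h2, h3]

theorem IsConvex.isNaturallyQuasiconvex {ρ : Lp ℝ p P → lpMeas ℝ ℝ mG p P} (h : IsConvex ρ) :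
    IsNaturallyQuasiconvex ρ :=
  fun X Y t ht => ⟨t, ht, h X Y t ht⟩

/-- The weight is the one for the pair X 1_A + U 1_Aᶜ, Y 1_A + V 1_Aᶜ; locality separates the two
sets. -/
theorem IsNaturallyQuasiconvex.jointly [IsFiniteMeasure P] {hG : mG ≤ mF} (hp : 1 ≤ p)
    {ρ : Lp ℝ p P → lpMeas ℝ ℝ mG p P} (hρ : IsNaturallyQuasiconvex ρ) (hlocal : IsLocal hG ρ)
    {A : Set Ω} (hA : MeasurableSet[mG] A) (X Y U V : Lp ℝ p P) {t : ℝ}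
    (ht : t ∈ Set.Icc (0 : ℝ) 1) :
    ∃ s ∈ Set.Icc (0 : ℝ) 1,
      ∫ ω in A, (ρ (t • X + (1 - t) • Y) : Lp ℝ p P) ω ∂P ≤
        s * (∫ ω in A, (ρ X : Lp ℝ p P) ω ∂P) + (1 - s) * ∫ ω in A, (ρ Y : Lp ℝ p P) ω ∂P ∧
      ∫ ω in Aᶜ, (ρ (t • U + (1 - t) • V) : Lp ℝ p P) ω ∂P ≤
        s * (∫ ω in Aᶜ, (ρ U : Lp ℝ p P) ω ∂P) + (1 - s) * ∫ ω in Aᶜ, (ρ V : Lp ℝ p P) ω ∂P := by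
  have hA' := hG A hA
  let glue (X U : Lp ℝ p P) : Lp ℝ p P := restrictTo A hA' X + restrictTo Aᶜ hA'.compl U
  have hglue : ∀ X U : Lp ℝ p P, (∀ᵐ ω ∂P, ω ∈ A → glue X U ω = X ω) ∧
      ∀ᵐ ω ∂P, ω ∈ Aᶜ → glue X U ω = U ω := by
    intro X U
    constructor <;>
    · filter_upwards [Lp.coeFn_add (restrictTo A hA' X) (restrictTo Aᶜ hA'.compl U),
        coeFn_restrictTo hA' X, coeFn_restrictTo hA'.compl U] with ω h1 h2 h3 hω
      rw [h1, Pi.add_apply, h2, h3]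
      simp_all
  have hcomb : ∀ {B : Set Ω} {X X' Y Y' : Lp ℝ p P}, (∀ᵐ ω ∂P, ω ∈ B → X ω = X' ω) →
      (∀ᵐ ω ∂P, ω ∈ B → Y ω = Y' ω) →
      ∀ᵐ ω ∂P, ω ∈ B → (t • X + (1 - t) • Y) ω = (t • X' + (1 - t) • Y') ω := by
    intro B X X' Y Y' h1 h2
    filter_upwards [h1, h2, coeFn_combination t (1 - t) X Y, coeFn_combination t (1 - t) X' Y']
      with ω h1 h2 h3 h4 hω
    rw [h3, h4, h1 hω, h2 hω]
  have hint : ∀ {B : Set Ω} {X X' : Lp ℝ p P}, MeasurableSet[mG] B →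
      (∀ᵐ ω ∂P, ω ∈ B → X ω = X' ω) →
      ∫ ω in B, (ρ X : Lp ℝ p P) ω ∂P = ∫ ω in B, (ρ X' : Lp ℝ p P) ω ∂P :=
    fun hB h => setIntegral_congr_ae (hG _ hB) (hlocal.ae_eq_of_ae_eq hB h)
  obtain ⟨s, hs, hle⟩ := hρ (glue X U) (glue Y V) t ht
  refine ⟨s, hs, ?_, ?_⟩
  · have := setIntegral_le_of_le_combination hp (A := A) hle
    rwa [hint hA (hglue X U).1, hint hA (hglue Y V).1,
      hint hA (hcomb (hglue X U).1 (hglue Y V).1)] at this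
  · have := setIntegral_le_of_le_combination hp (A := Aᶜ) hle
    rwa [hint hA.compl (hglue X U).2, hint hA.compl (hglue Y V).2,
      hint hA.compl (hcomb (hglue X U).2 (hglue Y V).2)] at this

theorem IsNaturallyQuasiconvex.isConvex [IsProbabilityMeasure P] {hG : mG ≤ mF} (hp : 1 ≤ p)
    (hnontriv : ∃ A₀ : Set Ω, MeasurableSet[mG] A₀ ∧ 0 < P A₀ ∧ P A₀ < 1)
    {ρ : Lp ℝ p P → lpMeas ℝ ℝ mG p P} (hρ : IsNaturallyQuasiconvex ρ) (hlocal : IsLocal hG ρ)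
    (hnonconst : IsNowhereConstant ρ) : IsConvex ρ := by
  obtain ⟨A₀, hA₀, hpos, hlt⟩ := hnontriv
  intro X Y t ht
  -- P(A) < 1 leaves Aᶜ with positive probability, so g is not constant.
  have hproper : ∀ A, MeasurableSet[mG] A → P A < 1 →
      ∫ ω in A, (ρ (t • X + (1 - t) • Y) : Lp ℝ p P) ω ∂P ≤
        t * (∫ ω in A, (ρ X : Lp ℝ p P) ω ∂P) + (1 - t) * ∫ ω in A, (ρ Y : Lp ℝ p P) ω ∂P := by
    intro A hA hA1
    have hcompl : 0 < P Aᶜ := by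
      rw [prob_compl_eq_one_sub (hG A hA)]
      exact tsub_pos_of_lt hA1
    have := convexOn_of_jointly_naturally_quasiconvex
      (f := fun X => ∫ ω in A, (ρ X : Lp ℝ p P) ω ∂P)
      (g := fun X => ∫ ω in Aᶜ, (ρ X : Lp ℝ p P) ω ∂P)
      (fun x y u v t ht => hρ.jointly hp hlocal hA x y u v ht) (hnonconst Aᶜ hA.compl hcompl)
    simpa using this.2 (Set.mem_univ X) (Set.mem_univ Y) ht.1 (sub_nonneg.2 ht.2) (by ring)
  refine le_of_forall_setIntegral_le hG hp (ρ (t • X + (1 - t) • Y))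
    (t • ρ X + (1 - t) • ρ Y) fun A hA => ?_
  -- A may have full measure, but both its pieces along A₀ have probability below 1.
  have hsplit : ∀ W : Lp ℝ p P,
      ∫ ω in A, W ω ∂P = ∫ ω in A ∩ A₀, W ω ∂P + ∫ ω in A \ A₀, W ω ∂P := fun W =>
    (integral_inter_add_sdiff (hG _ hA₀) (integrable_coeFn hp W).integrableOn).symm
  have h1 := hproper (A ∩ A₀) (hA.inter hA₀) ((measure_mono Set.inter_subset_right).trans_lt hlt)
  have h2 := hproper (A \ A₀) (hA.diff hA₀) (by
    refine (measure_mono (show A \ A₀ ⊆ A₀ᶜ from fun ω hω => hω.2)).trans_lt ?_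
    rw [prob_compl_eq_one_sub (hG _ hA₀)]
    exact ENNReal.sub_lt_self (by simp) (by simp) hpos.ne')
  have h3 : ∫ ω in A, ((t • ρ X + (1 - t) • ρ Y : lpMeas ℝ ℝ mG p P) : Lp ℝ p P) ω ∂P =
      t * (∫ ω in A, (ρ X : Lp ℝ p P) ω ∂P) + (1 - t) * ∫ ω in A, (ρ Y : Lp ℝ p P) ω ∂P := by
    rw [← integral_const_mul, ← integral_const_mul, ← integral_add
      ((integrable_coeFn hp _).integrableOn.const_mul t)
      ((integrable_coeFn hp _).integrableOn.const_mul (1 - t))]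
    exact integral_congr_ae (ae_restrict_of_ae (coeFn_combination t (1 - t) _ _))
  rw [h3, hsplit, hsplit (ρ X), hsplit (ρ Y)]
  linarith

end CondRisk

theorem theorem3p9 {Ω : Type*} {mG mF : MeasurableSpace Ω} (hG : mG ≤ mF)
    (P : Measure Ω) [IsProbabilityMeasure P]
    (p q : ℝ≥0∞) [Fact (1 ≤ p)] [ENNReal.HolderConjugate p q]
    (hnontriv : ∃ A₀ : Set Ω, MeasurableSet[mG] A₀ ∧ 0 < P A₀ ∧ P A₀ < 1)
    (ρ : Lp ℝ p P → lpMeas ℝ ℝ mG p P)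
    (hρ : CondRisk.IsConditionalRiskMeasure ρ)
    (hlocal : CondRisk.IsLocal hG ρ)
    (hlsc : CondRisk.IsStarLSC q ρ)
    (hnonconst : CondRisk.IsNowhereConstant ρ) :
    CondRisk.IsConvex ρ ↔ CondRisk.IsNaturallyQuasiconvex ρ :=
  ⟨fun h => h.isNaturallyQuasiconvex,
    fun h => h.isConvex (Fact.out : 1 ≤ p) hnontriv hlocal hnonconst⟩
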